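/- For $n\ge 5$ let $Q_n=\{1,\dots,n\}$, $\Sigma=\{a,b,c,d,e,f\}$, and let $\mathcal D_n=(Q_n,\Sigma,\delta_n,1,\{n\})$ be the deterministic finite automaton with initial state $1$, unique final state $n$, whose letters induce the following transformations of $Q_n$ (states not mentioned are fixed): $a$ is the cycle $(2,3,\dots,n-1)$; $b$ is the transposition $(2,3)$; $c$ maps $n-1$ to $2$; $d$ maps $n-1$ to $1$; $e$ maps every state of $\{1,\dots,n-1\}$ to $2$; $f$ maps $2$ to $n$. Let $L_n\subseteq\Sigma^*$ be the language accepted by $\mathcal D_n$. Over the five-letter alphabet $\Gamma=\{a,b,d,e,f\}$, let $L_n(a,b,-,d,e,f)=L_n\cap\Gamma^*$, and let $L_n(b,a,-,d,e,f)\subseteq\Gamma^*$ be the language obtained from $L_n\cap\Gamma^*$ by interchanging the letters $a$ and $b$ in every word. The complexity of a language $L\subseteq\Gamma^*$ is the number of distinct left quotients $w^{-1}L=\{x\in\Gamma^*\mid wx\in L\}$, $w\in\Gamma^*$ (equivalently, for regular $L$, the number of states of a minimal deterministic finite automaton over $\Gamma$ accepting $L$). **Theorem (Two-Sided Ideals: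 Boolean Operations).** Let $m,n\ge 5$. 1. The complexity of $L_m(a,b,-,d,e,f)\cap L_n(b,a,-,d,e,f)$ is $mn$. 2. The complexity of the symmetric difference $L_m(a,b,-,d,e,f)\oplus L_n(b,a,-,d,e,f)$ is $mn$. 3. The complexity of $L_m(a,b,-,d,e,f)\setminus L_n(b,a,-,d,e,f)$ is $mn-(m-1)$. 4. The complexity of $L_m(a,b,-,d,e,f)\cup L_n(b,a,-,d,e,f)$ is $mn-(m+n-2)$. -/

import Mathlib

namespace TwoSidedIdeals

/-- The six-letter ordered alphabet `Σ = {a, b, c, d, e, f}`. -/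
inductive Letter
  | a | b | c | d | e | f
  deriving DecidableEq

/-- The quotient complexity (equivalently, state complexity) of a language over the alphabet `α`:
the number of its left quotients `w⁻¹L = {x | wx ∈ L}`, `w` ranging over all words over `α`.
(`Set.ncard` is `0` on infinite sets; as `L` is always among its own quotients, a positive value
means exactly that the set of quotients is finite with that many elements.) -/
noncomputable def complexity {α : Type*} (L : Language α) : ℕ :=
  (Set.range L.leftQuotient).ncard

/-- The image of a language under the substitution `s_π` of a partial map `π` of letters:
a letter `x` goes to `{π x}` where `π x` is defined, and to `∅` where it is undefined (`none`).
So the words of `L` that contain a letter with undefined image contribute nothing. -/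
def dialect {α β : Type*} (π : α → Option β) (L : Language α) : Language β :=
  {w | ∃ v ∈ L, v.map π = w.map some}

/-- The set of states `Q_n = {1, 2, …, n}`. -/
abbrev State (n : ℕ) : Type := {q : ℕ // 1 ≤ q ∧ q ≤ n}

/-- The transformations of `Q_n` induced by the letters. -/
def act (n : ℕ) : Letter → ℕ → ℕ
  -- the cycle `(2, 3, …, n-1)`
  | .a, q => if 2 ≤ q ∧ q + 1 < n then q + 1 else if q + 1 = n then 2 else q
  -- the transposition `(2, 3)`
  | .b, q => if q = 2 then 3 else if q = 3 then 2 else q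
  -- `(n-1 → 2)`
  | .c, q => if q + 1 = n then 2 else q
  -- `(n-1 → 1)`
  | .d, q => if q + 1 = n then 1 else q
  -- `(Q_{n-1} → 2)`
  | .e, q => if q < n then 2 else q
  -- `(2 → n)`
  | .f, q => if q = 2 then n else q

theorem act_mem {n : ℕ} (hn : 5 ≤ n) (x : Letter) (q : ℕ) (hq : 1 ≤ q ∧ q ≤ n) :
    1 ≤ act n x q ∧ act n x q ≤ n := by
  cases x <;> simp only [act] <;> split_ifs <;> omega

/-- The automaton `D_n(a,b,c,d,e,f) = (Q_n, Σ, δ, 1, {n})`, `n ≥ 5`. -/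
def witnessDFA (n : ℕ) (hn : 5 ≤ n) : DFA Letter (State n) where
  step q x := ⟨act n x q.1, act_mem hn x q.1 q.2⟩
  start := ⟨1, by omega⟩
  accept := {q | q.1 = n}

/-- The language `L_n(a,b,c,d,e,f)`. -/
def witness (n : ℕ) (hn : 5 ≤ n) : Language Letter :=
  (witnessDFA n hn).accepts

/-- The five-letter alphabet `{a, b, d, e, f} = Σ \ {c}` over which the dialects below live. -/
abbrev SubLetter : Type := {x : Letter // x ≠ Letter.c}

/-- The partial permutation `(a, b, c, d, e, f) ↦ (a, b, -, d, e, f)`. -/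
def permAB : Letter → Option SubLetter
  | .a => some ⟨.a, by decide⟩
  | .b => some ⟨.b, by decide⟩
  | .c => none
  | .d => some ⟨.d, by decide⟩
  | .e => some ⟨.e, by decide⟩
  | .f => some ⟨.f, by decide⟩

/-- The partial permutation `(a, b, c, d, e, f) ↦ (b, a, -, d, e, f)`. -/
def permBA : Letter → Option SubLetter
  | .a => some ⟨.b, by decide⟩
  | .b => some ⟨.a, by decide⟩
  | .c => none
  | .d => some ⟨.d, by decide⟩
  | .e => some ⟨.e, by decide⟩
  | .f => some ⟨.f, by decide⟩

/-- The dialect `L_n(a,b,-,d,e,f)`, a language over `{a, b, d, e, f}`. -/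
def witnessAB (n : ℕ) (hn : 5 ≤ n) : Language SubLetter :=
  dialect permAB (witness n hn)

/-- The dialect `L_n(b,a,-,d,e,f)`, a language over `{a, b, d, e, f}`. -/
def witnessBA (n : ℕ) (hn : 5 ≤ n) : Language SubLetter :=
  dialect permBA (witness n hn)

end TwoSidedIdeals

/-!
Each Boolean combination is accepted by the direct product of the automata of the two dialects, with
a suitable set of accepting pairs. All `m n` pairs of states are reachable. Indeed the letter acting
as the cycle in one automaton acts as the transposition `(2, 3)` in the other, so that one component
can be cycled without moving the other as long as the latter is outside `{2, 3}`; `d` and `f`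
then give the pairs with a component `1` or a final component.

Two distinct pairs with the same final components can be moved, by the same cycles followed by `f`,
to pairs with different final components, in such a way that one of them keeps its pattern. Hence it
only matters which patterns of final components are told apart. For intersection and symmetric
difference all of them are. For the difference the `m` pairs with final second component accept
nothing and are merged, and for the union the `m + n - 1` pairs with a final component accept
everything and are merged.
-/

namespace TwoSidedIdeals

section Automata

variable {α β σ σ₁ σ₂ : Type*}

theorem complexity_accepts (M : DFA α σ) :
    complexity M.accepts = (M.acceptsFrom '' Set.range M.eval).ncard := by
  rw [complexity, Language.leftQuotient_accepts, Set.range_comp]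

theorem complexity_accepts_of_injOn {M : DFA α σ}
    (hinj : Set.InjOn M.acceptsFrom (Set.range M.eval)) :
    complexity M.accepts = (Set.range M.eval).ncard := by
  rw [complexity_accepts, hinj.ncard_image]

theorem complexity_accepts_eq_ncard_inter_add_one {M : DFA α σ} {N : Set σ} {c : σ}
    (hfin : (Set.range M.eval).Finite) (hc : c ∈ Set.range M.eval) (hcN : c ∉ N)
    (hcollapse : ∀ s ∈ Set.range M.eval, s ∉ N → M.acceptsFrom s = M.acceptsFrom c)
    (hsep : ∀ s ∈ Set.range M.eval ∩ N, ∀ t ∈ Set.range M.eval,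
      M.acceptsFrom s = M.acceptsFrom t → s = t) :
    complexity M.accepts = (Set.range M.eval ∩ N).ncard + 1 := by
  have himage : M.acceptsFrom '' Set.range M.eval =
      insert (M.acceptsFrom c) (M.acceptsFrom '' (Set.range M.eval ∩ N)) := by
    refine subset_antisymm ?_
      (Set.insert_subset ⟨c, hc, rfl⟩ (Set.image_mono Set.inter_subset_left))
    rintro _ ⟨s, hs, rfl⟩
    by_cases hsN : s ∈ N
    · exact Or.inr ⟨s, ⟨hs, hsN⟩, rfl⟩
    · exact Or.inl (hcollapse s hs hsN)
  have hc_notMem : M.acceptsFrom c ∉ M.acceptsFrom '' (Set.range M.eval ∩ N) := by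
    rintro ⟨s, hs, hsc⟩
    exact hcN (hsep s hs c hc hsc ▸ hs.2)
  have hinj : Set.InjOn M.acceptsFrom (Set.range M.eval ∩ N) :=
    fun s hs t ht h => hsep s hs t ht.1 h
  rw [complexity_accepts, himage,
    Set.ncard_insert_of_notMem hc_notMem ((hfin.subset Set.inter_subset_left).image _),
    hinj.ncard_image]

theorem acceptsFrom_evalFrom (M : DFA α σ) (s : σ) (w : List α) :
    M.acceptsFrom (M.evalFrom s w) = (M.acceptsFrom s).leftQuotient w := by
  ext v
  simp only [DFA.mem_acceptsFrom, Language.mem_leftQuotient, DFA.evalFrom_of_append]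

theorem evalFrom_replicate (M : DFA α σ) (s : σ) (x : α) (k : ℕ) :
    M.evalFrom s (List.replicate k x) = (fun q => M.step q x)^[k] s := by
  induction k generalizing s with
  | zero => rfl
  | succ k ih => rw [List.replicate_succ, DFA.evalFrom_cons, ih, Function.iterate_succ_apply]

theorem evalFrom_mem {M : DFA α σ} {S : Set σ} (hS : ∀ s ∈ S, ∀ x, M.step s x ∈ S) {s : σ}
    (hs : s ∈ S) (w : List α) : M.evalFrom s w ∈ S := by
  induction w generalizing s with
  | nil => exact hs
  | cons x _ ih => exact ih (hS s hs x)

theorem evalFrom_eq_self {M : DFA α σ} {s : σ} (hs : ∀ x, M.step s x = s) (w : List α) :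
    M.evalFrom s w = s :=
  evalFrom_mem (S := {s}) (fun _ ht x => ht ▸ hs x) rfl w

theorem dialect_accepts {π : α → Option β} {ι : β → α} (hπ : ∀ x y, π x = some y ↔ x = ι y)
    (M : DFA α σ) : dialect π M.accepts = (M.comap ι).accepts := by
  have map_eq_iff : ∀ (v : List α) (w : List β), v.map π = w.map some ↔ v = w.map ι := by
    intro v
    induction v with
    | nil => intro w; cases w <;> simp
    | cons x v ih => intro w; cases w <;> simp [ih, hπ]
  rw [DFA.accepts_comap]
  ext w
  change (∃ v ∈ M.accepts, v.map π = w.map some) ↔ w.map ι ∈ M.accepts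
  simp only [map_eq_iff, exists_eq_right]

/-- The direct product of two automata over the same alphabet. The set `F` of accepting pairs is a
parameter: each Boolean operation on the two languages corresponds to one choice of `F`. -/
def productDFA (M₁ : DFA α σ₁) (M₂ : DFA α σ₂) (F : Set (σ₁ × σ₂)) : DFA α (σ₁ × σ₂) where
  step s x := (M₁.step s.1 x, M₂.step s.2 x)
  start := (M₁.start, M₂.start)
  accept := F

variable {M₁ : DFA α σ₁} {M₂ : DFA α σ₂} {F : Set (σ₁ × σ₂)}

theorem evalFrom_productDFA (s : σ₁ × σ₂) (w : List α) :
    (productDFA M₁ M₂ F).evalFrom s w = (M₁.evalFrom s.1 w, M₂.evalFrom s.2 w) := by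
  induction w generalizing s with
  | nil => rfl
  | cons x _ ih => exact ih _

theorem accepts_productDFA :
    (productDFA M₁ M₂ F).accepts = {w | (M₁.eval w, M₂.eval w) ∈ F} := by
  ext w
  change (productDFA M₁ M₂ F).evalFrom (M₁.start, M₂.start) w ∈ F ↔ _
  rw [evalFrom_productDFA]
  rfl

theorem mem_acceptsFrom_productDFA {s : σ₁ × σ₂} {w : List α} :
    w ∈ (productDFA M₁ M₂ F).acceptsFrom s ↔ (M₁.evalFrom s.1 w, M₂.evalFrom s.2 w) ∈ F := by
  rw [DFA.mem_acceptsFrom, evalFrom_productDFA]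
  rfl

end Automata

section Witnesses

/-- The automaton `D_n` with its transition functions extended to all of `ℕ`. From the initial
state `1` only the states of `Q_n = {1, …, n}` are reached. -/
def actDFA (n : ℕ) : DFA Letter ℕ where
  step q x := act n x q
  start := 1
  accept := {n}

theorem accepts_actDFA (n : ℕ) (hn : 5 ≤ n) : (actDFA n).accepts = witness n hn := by
  have evalFrom_coe : ∀ (w : List Letter) (q : State n),
      ((witnessDFA n hn).evalFrom q w : ℕ) = (actDFA n).evalFrom q w := by
    intro w
    induction w with
    | nil => exact fun _ => rfl
    | cons x _ ih => exact fun q => ih _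
  ext w
  change (actDFA n).evalFrom 1 w = n ↔ ((witnessDFA n hn).evalFrom ⟨1, _⟩ w : ℕ) = n
  rw [evalFrom_coe]

abbrev SubLetter.a : SubLetter := ⟨.a, by decide⟩
abbrev SubLetter.b : SubLetter := ⟨.b, by decide⟩
abbrev SubLetter.d : SubLetter := ⟨.d, by decide⟩
abbrev SubLetter.e : SubLetter := ⟨.e, by decide⟩
abbrev SubLetter.f : SubLetter := ⟨.f, by decide⟩

/-- The interchange of the letters `a` and `b`. -/
def swapAB : SubLetter → SubLetter
  | ⟨.a, _⟩ => .b
  | ⟨.b, _⟩ => .a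
  | x => x

theorem swapAB_involutive : Function.Involutive swapAB := by
  rintro ⟨x, hx⟩
  cases x <;> rfl

/-- The automaton of the dialect `L_n(a,b,-,d,e,f)`. -/
def abDFA (n : ℕ) : DFA SubLetter ℕ :=
  (actDFA n).comap Subtype.val

/-- The automaton of the dialect `L_n(b,a,-,d,e,f)`. -/
def baDFA (n : ℕ) : DFA SubLetter ℕ :=
  (abDFA n).comap swapAB

theorem permAB_eq_some_iff (x : Letter) (y : SubLetter) : permAB x = some y ↔ x = y.1 := by
  obtain ⟨y, hy⟩ := y
  cases x <;> cases y <;> simp [permAB] at hy ⊢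

theorem permBA_eq_some_iff (x : Letter) (y : SubLetter) :
    permBA x = some y ↔ x = (swapAB y).1 := by
  obtain ⟨y, hy⟩ := y
  cases x <;> cases y <;> simp [permBA, swapAB] at hy ⊢

theorem accepts_abDFA (n : ℕ) (hn : 5 ≤ n) : (abDFA n).accepts = witnessAB n hn := by
  rw [witnessAB, ← accepts_actDFA, dialect_accepts permAB_eq_some_iff, abDFA]

theorem accepts_baDFA (n : ℕ) (hn : 5 ≤ n) : (baDFA n).accepts = witnessBA n hn := by
  rw [witnessBA, ← accepts_actDFA, dialect_accepts permBA_eq_some_iff]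
  rfl

theorem evalFrom_baDFA_map_swapAB (n q : ℕ) (w : List SubLetter) :
    (baDFA n).evalFrom q (w.map swapAB) = (abDFA n).evalFrom q w := by
  rw [baDFA, DFA.evalFrom_comap, List.map_map, swapAB_involutive.comp_self, List.map_id]

theorem evalFrom_abDFA_map_swapAB (n q : ℕ) (w : List SubLetter) :
    (abDFA n).evalFrom q (w.map swapAB) = (baDFA n).evalFrom q w := by
  rw [baDFA, DFA.evalFrom_comap]

end Witnesses

section Letters

variable {n : ℕ}

theorem act_final (hn : 5 ≤ n) (x : Letter) : act n x n = n := by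
  cases x <;> grind [act]

theorem act_a_injective (hn : 5 ≤ n) : Function.Injective (act n .a) := by
  intro p q h
  grind [act]

theorem act_b_injective : Function.Injective (act n .b) := by
  intro p q h
  grind [act]

theorem act_b_eq_self {q : ℕ} (h₂ : q ≠ 2) (h₃ : q ≠ 3) : act n .b q = q := by
  grind [act]

theorem iterate_act_b_mem_Ico (hn : 5 ≤ n) {q : ℕ} (hq : q ∈ Set.Ico 2 n) (k : ℕ) :
    (act n .b)^[k] q ∈ Set.Ico 2 n :=
  Set.MapsTo.iterate (fun r (hr : r ∈ Set.Ico 2 n) => by grind [act]) k hq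

theorem iterate_act_a_of_add_lt {q k : ℕ} (hq : 2 ≤ q) (hk : q + k < n) :
    (act n .a)^[k] q = q + k := by
  induction k with
  | zero => rfl
  | succ k ih =>
    rw [Function.iterate_succ_apply', ih (by omega)]
    grind [act]

theorem exists_iterate_act_a_eq {p q : ℕ} (hp : p ∈ Set.Ico 2 n) (hq : q ∈ Set.Ico 2 n) :
    ∃ k, (act n .a)^[k] p = q := by
  obtain ⟨hp₂, hpn⟩ := hp
  obtain ⟨hq₂, hqn⟩ := hq
  have to_last : (act n .a)^[n - 1 - p] p = n - 1 := by
    rw [iterate_act_a_of_add_lt hp₂ (by omega)]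
    omega
  have last_to_two : act n .a (n - 1) = 2 := by grind [act]
  have from_two : (act n .a)^[q - 2] 2 = q := by
    rw [iterate_act_a_of_add_lt le_rfl (by omega)]
    omega
  refine ⟨(q - 2) + 1 + (n - 1 - p), ?_⟩
  rw [Function.iterate_add_apply, Function.iterate_succ_apply, to_last, last_to_two, from_two]

theorem evalFrom_abDFA_final (hn : 5 ≤ n) (w : List SubLetter) : (abDFA n).evalFrom n w = n :=
  evalFrom_eq_self (M := abDFA n) (fun x => act_final hn x.1) w

theorem evalFrom_baDFA_final (hn : 5 ≤ n) (w : List SubLetter) : (baDFA n).evalFrom n w = n :=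
  evalFrom_eq_self (M := baDFA n) (fun x => act_final hn (swapAB x).1) w

theorem evalFrom_abDFA_replicate (q : ℕ) (x : SubLetter) (k : ℕ) :
    (abDFA n).evalFrom q (List.replicate k x) = (act n x)^[k] q :=
  evalFrom_replicate _ _ _ _

theorem evalFrom_baDFA_replicate (q : ℕ) (x : SubLetter) (k : ℕ) :
    (baDFA n).evalFrom q (List.replicate k x) = (act n (swapAB x))^[k] q :=
  evalFrom_replicate _ _ _ _

end Letters

section Reachability

variable {m n : ℕ}

/-- Reachability in the product of the automata of the two dialects: some word takes `s.1` to `t.1`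
in the first automaton and `s.2` to `t.2` in the second. -/
def Reaches (m n : ℕ) (s t : ℕ × ℕ) : Prop :=
  ∃ w, (abDFA m).evalFrom s.1 w = t.1 ∧ (baDFA n).evalFrom s.2 w = t.2

theorem Reaches.refl (s : ℕ × ℕ) : Reaches m n s s := ⟨[], rfl, rfl⟩

theorem Reaches.trans {s t u : ℕ × ℕ} (hst : Reaches m n s t) (htu : Reaches m n t u) :
    Reaches m n s u := by
  obtain ⟨v, hv₁, hv₂⟩ := hst
  obtain ⟨w, hw₁, hw₂⟩ := htu
  exact ⟨v ++ w, by rw [DFA.evalFrom_of_append, hv₁, hw₁], by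
    rw [DFA.evalFrom_of_append, hv₂, hw₂]⟩

theorem Reaches.swap {s t : ℕ × ℕ} (h : Reaches m n s t) : Reaches n m s.swap t.swap := by
  obtain ⟨w, hw₁, hw₂⟩ := h
  exact ⟨w.map swapAB, (evalFrom_abDFA_map_swapAB _ _ _).trans hw₂,
    (evalFrom_baDFA_map_swapAB _ _ _).trans hw₁⟩

theorem reaches_iterate (s : ℕ × ℕ) (x : SubLetter) (k : ℕ) :
    Reaches m n s ((act m x)^[k] s.1, (act n (swapAB x))^[k] s.2) :=
  ⟨List.replicate k x, evalFrom_abDFA_replicate _ _ _, evalFrom_baDFA_replicate _ _ _⟩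

theorem Reaches.letter {s : ℕ × ℕ} {p q p' q' : ℕ} (h : Reaches m n s (p, q)) (x : SubLetter)
    (hp : act m x p = p') (hq : act n (swapAB x) q = q') : Reaches m n s (p', q') :=
  h.trans ⟨[x], hp, hq⟩

/-- `p = 4, …, m - 1` is reached by the cycle `a` of the first automaton and then fixed by `b`,
which is the cycle of the second. -/
theorem reaches_of_four_le (hm : 5 ≤ m) (hn : 5 ≤ n) {p q : ℕ} (hp : p ∈ Set.Ico 4 m)
    (hq : q ∈ Set.Ico 2 n) : Reaches m n (2, 2) (p, q) := by
  obtain ⟨k, hk⟩ := exists_iterate_act_a_eq (p := 2) (q := p) (n := m)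
    ⟨le_rfl, by omega⟩ ⟨by grind, hp.2⟩
  obtain ⟨j, hj⟩ := exists_iterate_act_a_eq
    (iterate_act_b_mem_Ico hn ⟨le_rfl, by omega⟩ k) hq
  have hb : (act m .b)^[j] p = p :=
    Function.iterate_fixed (act_b_eq_self (by grind) (by grind)) j
  have h := (reaches_iterate (m := m) (n := n) (2, 2) .a k).trans (reaches_iterate _ .b j)
  simpa only [swapAB, hk, hj, hb] using h

theorem reaches_of_mem_Ico_two (hm : 5 ≤ m) (hn : 5 ≤ n) {p q : ℕ} (hp : p ∈ Set.Ico 2 m)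
    (hq : q ∈ Set.Ico 2 n) : Reaches m n (2, 2) (p, q) := by
  by_cases hp₄ : 4 ≤ p
  · exact reaches_of_four_le hm hn ⟨hp₄, hp.2⟩ hq
  by_cases hq₄ : 4 ≤ q
  · exact (reaches_of_four_le hn hm ⟨hq₄, hq.2⟩ hp).swap
  have h₂₃ : Reaches m n (2, 2) (2, 3) :=
    (reaches_of_four_le (p := m - 1) (q := 2) hm hn (by grind) (by grind)).letter .a
      (by grind [act]) (by grind [act, swapAB])
  have h₃₃ : Reaches m n (2, 2) (3, 3) :=
    (Reaches.refl _).letter .a (by grind [act]) (by grind [act, swapAB])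
  have h₃₂ : Reaches m n (2, 2) (3, 2) :=
    h₂₃.letter .a (by grind [act]) (by grind [act, swapAB])
  obtain rfl | rfl : p = 2 ∨ p = 3 := by grind
  all_goals obtain rfl | rfl : q = 2 ∨ q = 3 := by grind
  exacts [Reaches.refl _, h₂₃, h₃₂, h₃₃]

theorem reaches_one_left (hm : 5 ≤ m) (hn : 5 ≤ n) {q : ℕ} (hq : q ∈ Set.Ico 1 n) :
    Reaches m n (2, 2) (1, q) := by
  have h_last : ∀ r ∈ Set.Ico 2 n, Reaches m n (2, 2) (m - 1, r) :=
    fun r hr => reaches_of_mem_Ico_two hm hn (by grind) hr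
  have h_inner : ∀ r ∈ Set.Ico 2 (n - 1), Reaches m n (2, 2) (1, r) := fun r hr =>
    (h_last r (by grind)).letter .d (by grind [act]) (by grind [act, swapAB])
  obtain rfl | hq_inner | rfl : q = 1 ∨ q ∈ Set.Ico 2 (n - 1) ∨ q = n - 1 := by grind
  · exact (h_last (n - 1) (by grind)).letter .d (by grind [act]) (by grind [act, swapAB])
  · exact h_inner q hq_inner
  · exact (h_inner (n - 2) (by grind)).letter .b (by grind [act]) (by grind [act, swapAB])

theorem reaches_of_mem_Ico_one (hm : 5 ≤ m) (hn : 5 ≤ n) {p q : ℕ} (hp : p ∈ Set.Ico 1 m)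
    (hq : q ∈ Set.Ico 1 n) : Reaches m n (2, 2) (p, q) := by
  obtain rfl | hp₂ : p = 1 ∨ p ∈ Set.Ico 2 m := by grind
  · exact reaches_one_left hm hn hq
  obtain rfl | hq₂ : q = 1 ∨ q ∈ Set.Ico 2 n := by grind
  · exact (reaches_one_left hn hm hp).swap
  exact reaches_of_mem_Ico_two hm hn hp₂ hq₂

theorem reaches_final_right (hm : 5 ≤ m) (hn : 5 ≤ n) {p : ℕ} (hp : p ∈ Set.Ico 1 m) :
    Reaches m n (2, 2) (p, n) := by
  have h_ne_two : ∀ r ∈ Set.Ico 1 m, r ≠ 2 → Reaches m n (2, 2) (r, n) := fun r hr hr₂ =>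
    (reaches_of_mem_Ico_one (q := 2) hm hn hr (by grind)).letter .f
      (by grind [act]) (by grind [act, swapAB])
  obtain rfl | hp₂ := eq_or_ne p 2
  · exact (h_ne_two (m - 1) (by grind) (by omega)).letter .a
      (by grind [act]) (by grind [act, swapAB])
  · exact h_ne_two p hp hp₂

theorem reaches_of_mem_Icc (hm : 5 ≤ m) (hn : 5 ≤ n) {p q : ℕ} (hp : p ∈ Set.Icc 1 m)
    (hq : q ∈ Set.Icc 1 n) : Reaches m n (2, 2) (p, q) := by
  obtain rfl | hpm := eq_or_lt_of_le hp.2 <;> obtain rfl | hqn := eq_or_lt_of_le hq.2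
  · exact (Reaches.refl _).letter .f (by grind [act]) (by grind [act, swapAB])
  · exact (reaches_final_right hn hm ⟨hq.1, hqn⟩).swap
  · exact reaches_final_right hm hn ⟨hp.1, hpm⟩
  · exact reaches_of_mem_Ico_one hm hn ⟨hp.1, hpm⟩ ⟨hq.1, hqn⟩

/-- The product `Q_m × Q_n` of the state sets of the two automata. -/
abbrev statePairs (m n : ℕ) : Set (ℕ × ℕ) := Set.Icc 1 m ×ˢ Set.Icc 1 n

/-- The product automaton of the dialects `L_m(a,b,-,d,e,f)` and `L_n(b,a,-,d,e,f)` with accepting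
set `F`. Like its factors it is defined on all of `ℕ × ℕ`. -/
def dialectDFA (m n : ℕ) (F : Set (ℕ × ℕ)) : DFA SubLetter (ℕ × ℕ) :=
  productDFA (abDFA m) (baDFA n) F

variable {F : Set (ℕ × ℕ)}

theorem accepts_dialectDFA :
    (dialectDFA m n F).accepts = {w | ((abDFA m).eval w, (baDFA n).eval w) ∈ F} :=
  accepts_productDFA

theorem evalFrom_dialectDFA (s : ℕ × ℕ) (w : List SubLetter) :
    (dialectDFA m n F).evalFrom s w = ((abDFA m).evalFrom s.1 w, (baDFA n).evalFrom s.2 w) :=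
  evalFrom_productDFA s w

theorem mem_acceptsFrom_dialectDFA {s : ℕ × ℕ} {w : List SubLetter} :
    w ∈ (dialectDFA m n F).acceptsFrom s ↔
      ((abDFA m).evalFrom s.1 w, (baDFA n).evalFrom s.2 w) ∈ F :=
  mem_acceptsFrom_productDFA

theorem evalFrom_dialectDFA_mem (hm : 5 ≤ m) (hn : 5 ≤ n) {s : ℕ × ℕ} (hs : s ∈ statePairs m n)
    (w : List SubLetter) : (dialectDFA m n F).evalFrom s w ∈ statePairs m n :=
  evalFrom_mem (M := dialectDFA m n F) (S := statePairs m n)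
    (fun t ht x => Set.mk_mem_prod (act_mem hm x.1 t.1 ht.1) (act_mem hn (swapAB x).1 t.2 ht.2))
    hs w

theorem range_eval_dialectDFA (hm : 5 ≤ m) (hn : 5 ≤ n) :
    Set.range (dialectDFA m n F).eval = statePairs m n := by
  have start_mem : ((1, 1) : ℕ × ℕ) ∈ statePairs m n :=
    ⟨⟨le_rfl, by omega⟩, ⟨le_rfl, by omega⟩⟩
  apply subset_antisymm
  · rintro _ ⟨w, rfl⟩
    exact evalFrom_dialectDFA_mem hm hn start_mem w
  · rintro ⟨p, q⟩ ⟨hp, hq⟩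
    have start_reaches : Reaches m n (1, 1) (2, 2) :=
      (Reaches.refl _).letter .e (by grind [act]) (by grind [act, swapAB])
    obtain ⟨w, hw₁, hw₂⟩ := start_reaches.trans (reaches_of_mem_Icc hm hn hp hq)
    exact ⟨w, (evalFrom_productDFA _ _).trans (Prod.ext hw₁ hw₂)⟩

end Reachability

section Separation

variable {m n : ℕ}

theorem exists_evalFrom_baDFA_eq_final (hm : 5 ≤ m) (hn : 5 ≤ n) :
    ∃ w, (∀ p < m, (abDFA m).evalFrom p w = 1) ∧ ∀ q ≤ n, (baDFA n).evalFrom q w = n := by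
  obtain ⟨u, hu₁, hu₂⟩ := reaches_of_mem_Icc (p := 1) (q := n) hm hn (by grind) (by grind)
  refine ⟨.e :: u, fun p hp => ?_, fun q hq => ?_⟩
  · have h_two : (abDFA m).step p .e = 2 := if_pos hp
    rw [DFA.evalFrom_cons, h_two, hu₁]
  · obtain rfl | hqn := eq_or_lt_of_le hq
    · exact evalFrom_baDFA_final hn _
    · have h_two : (baDFA n).step q .e = 2 := if_pos hqn
      rw [DFA.evalFrom_cons, h_two, hu₂]

theorem exists_evalFrom_abDFA_eq_final (hm : 5 ≤ m) (hn : 5 ≤ n) :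
    ∃ w, (∀ p ≤ m, (abDFA m).evalFrom p w = m) ∧ ∀ q < n, (baDFA n).evalFrom q w = 1 := by
  obtain ⟨w, hw₁, hw₂⟩ := exists_evalFrom_baDFA_eq_final hn hm
  refine ⟨w.map swapAB, fun p hp => ?_, fun q hq => ?_⟩
  · rw [evalFrom_abDFA_map_swapAB, hw₂ p hp]
  · rw [evalFrom_baDFA_map_swapAB, hw₁ q hq]

theorem exists_word_separating_fst_of_ne_two_three (hm : 5 ≤ m) {p p' q : ℕ} (hp : p ∈ Set.Ico 2 m)
    (hp' : p' ≠ m) (hne : p ≠ p') (hq₂ : q ≠ 2) (hq₃ : q ≠ 3) :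
    ∃ w, (abDFA m).evalFrom p w = m ∧ (abDFA m).evalFrom p' w ≠ m ∧
      (baDFA n).evalFrom q w = q := by
  obtain ⟨k, hk⟩ := exists_iterate_act_a_eq hp (q := 2) ⟨le_rfl, by omega⟩
  have iterate_injective := (act_a_injective hm).iterate k
  have hp'_ne_two : (act m .a)^[k] p' ≠ 2 := hk ▸ (iterate_injective.ne hne).symm
  have hp'_ne_final : (act m .a)^[k] p' ≠ m := by
    have h_fixed : (act m .a)^[k] m = m := Function.iterate_fixed (act_final hm _) k
    exact fun h => hp' (iterate_injective (h.trans h_fixed.symm))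
  have hq_fixed : (act n .b)^[k] q = q := Function.iterate_fixed (act_b_eq_self hq₂ hq₃) k
  refine ⟨List.replicate k .a ++ [.f], ?_, ?_, ?_⟩
  · have act_f_two : act m .f 2 = m := by grind [act]
    rw [DFA.evalFrom_of_append, evalFrom_abDFA_replicate, hk]
    exact act_f_two
  · rw [DFA.evalFrom_of_append, evalFrom_abDFA_replicate]
    exact ne_of_eq_of_ne (if_neg hp'_ne_two) hp'_ne_final
  · rw [DFA.evalFrom_of_append, evalFrom_baDFA_replicate, swapAB, hq_fixed]
    exact if_neg hq₂

theorem exists_word_separating_fst (hm : 5 ≤ m) (hn : 5 ≤ n) {p p' q : ℕ} (hp : p ∈ Set.Ico 2 m)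
    (hp' : p' ≠ m) (hne : p ≠ p') :
    ∃ w, (abDFA m).evalFrom p w = m ∧ (abDFA m).evalFrom p' w ≠ m ∧
      ((baDFA n).evalFrom q w = n ↔ q = n) := by
  by_cases hq : q ∈ Set.Ico 2 n
  · -- The cycle `b` of the second automaton moves `q` to `4`, out of the support `{2, 3}` of `a`.
    obtain ⟨j, hj⟩ := exists_iterate_act_a_eq hq (q := 4) ⟨by omega, by omega⟩
    have iterate_injective := (act_b_injective (n := m)).iterate j
    have hp'_ne_final : (act m .b)^[j] p' ≠ m := by
      have h_fixed : (act m .b)^[j] m = m := Function.iterate_fixed (act_final hm _) j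
      exact fun h => hp' (iterate_injective (h.trans h_fixed.symm))
    obtain ⟨w, hw₁, hw₂, hw₃⟩ := exists_word_separating_fst_of_ne_two_three (n := n) (q := 4) hm
      (iterate_act_b_mem_Ico hm hp j) hp'_ne_final (iterate_injective.ne hne)
      (by omega) (by omega)
    refine ⟨List.replicate j .b ++ w, ?_, ?_, ?_⟩
    · rwa [DFA.evalFrom_of_append, evalFrom_abDFA_replicate]
    · rwa [DFA.evalFrom_of_append, evalFrom_abDFA_replicate]
    · rw [DFA.evalFrom_of_append, evalFrom_baDFA_replicate, swapAB, hj, hw₃]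
      grind
  · obtain ⟨w, hw₁, hw₂, hw₃⟩ := exists_word_separating_fst_of_ne_two_three (n := n) (q := q) hm
      hp hp' hne (by grind) (by grind)
    exact ⟨w, hw₁, hw₂, by rw [hw₃]⟩

theorem exists_word_separating_snd (hm : 5 ≤ m) (hn : 5 ≤ n) {p q q' : ℕ} (hq : q ∈ Set.Ico 2 n)
    (hq' : q' ≠ n) (hne : q ≠ q') :
    ∃ w, (baDFA n).evalFrom q w = n ∧ (baDFA n).evalFrom q' w ≠ n ∧
      ((abDFA m).evalFrom p w = m ↔ p = m) := by
  obtain ⟨w, hw⟩ := exists_word_separating_fst (q := p) hn hm hq hq' hne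
  refine ⟨w.map swapAB, ?_⟩
  rwa [evalFrom_baDFA_map_swapAB, evalFrom_baDFA_map_swapAB, evalFrom_abDFA_map_swapAB]

/-- The relation between pairs of states which agree on which of their two components are final.
For a Boolean operation, acceptance in the product automaton depends only on the class of a pair. -/
def SameFinality (m n : ℕ) (s t : ℕ × ℕ) : Prop :=
  (s.1 = m ↔ t.1 = m) ∧ (s.2 = n ↔ t.2 = n)

theorem SameFinality.symm {s t : ℕ × ℕ} (h : SameFinality m n s t) : SameFinality m n t s :=
  ⟨h.1.symm, h.2.symm⟩

variable {F : Set (ℕ × ℕ)}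

theorem mem_iff_of_acceptsFrom_eq {s t : ℕ × ℕ}
    (h : (dialectDFA m n F).acceptsFrom s = (dialectDFA m n F).acceptsFrom t) : s ∈ F ↔ t ∈ F :=
  Set.ext_iff.mp h []

theorem exists_word_not_sameFinality (hm : 5 ≤ m) (hn : 5 ≤ n) {s t : ℕ × ℕ}
    (hs : s ∈ statePairs m n) (ht : t ∈ statePairs m n) (hne : s ≠ t)
    (hst : SameFinality m n s t) :
    ∃ w, ¬SameFinality m n ((dialectDFA m n F).evalFrom s w) ((dialectDFA m n F).evalFrom t w) ∧
      (SameFinality m n s ((dialectDFA m n F).evalFrom s w) ∨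
        SameFinality m n t ((dialectDFA m n F).evalFrom t w)) := by
  obtain ⟨p, q⟩ := s
  obtain ⟨p', q'⟩ := t
  simp only [Set.mem_prod, Set.mem_Icc] at hs ht
  simp only [SameFinality, evalFrom_dialectDFA] at hst ⊢
  obtain hp | rfl | hp := lt_trichotomy p p'
  · obtain ⟨w, hw⟩ := exists_word_separating_fst (p := p') (p' := p) (q := q) hm hn
      (by grind) (by grind) hp.ne'
    exact ⟨w, by grind⟩
  · obtain hq | hq := lt_or_gt_of_ne (show q ≠ q' by grind)
    · obtain ⟨w, hw⟩ := exists_word_separating_snd (p := p) (q := q') (q' := q) hm hn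
        (by grind) (by grind) hq.ne'
      exact ⟨w, by grind⟩
    · obtain ⟨w, hw⟩ := exists_word_separating_snd (p := p) (q := q) (q' := q') hm hn
        (by grind) (by grind) hq.ne'
      exact ⟨w, by grind⟩
  · obtain ⟨w, hw⟩ := exists_word_separating_fst (p := p) (p' := p') (q := q') hm hn
      (by grind) (by grind) hp.ne'
    exact ⟨w, by grind⟩

/-- The word of `exists_word_not_sameFinality` keeps one of the two pairs in its class, hence in
`N`, and the languages accepted from the two images are still equal. -/
theorem eq_of_acceptsFrom_eq (hm : 5 ≤ m) (hn : 5 ≤ n) {N : Set (ℕ × ℕ)}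
    (hN : ∀ s t, SameFinality m n s t → s ∈ N → t ∈ N)
    (hF : ∀ s ∈ statePairs m n, ∀ t ∈ statePairs m n, s ∈ N →
      (dialectDFA m n F).acceptsFrom s = (dialectDFA m n F).acceptsFrom t → SameFinality m n s t)
    {s t : ℕ × ℕ} (hs : s ∈ statePairs m n) (ht : t ∈ statePairs m n) (hsN : s ∈ N)
    (h : (dialectDFA m n F).acceptsFrom s = (dialectDFA m n F).acceptsFrom t) : s = t := by
  by_contra hne
  have hst := hF s hs t ht hsN h
  obtain ⟨w, hw, hsw | htw⟩ := exists_word_not_sameFinality (F := F) hm hn hs ht hne hst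
  all_goals
    have hw_eq : (dialectDFA m n F).acceptsFrom ((dialectDFA m n F).evalFrom s w) =
        (dialectDFA m n F).acceptsFrom ((dialectDFA m n F).evalFrom t w) := by
      rw [acceptsFrom_evalFrom, acceptsFrom_evalFrom, h]
    have hsw_mem := evalFrom_dialectDFA_mem (F := F) hm hn hs w
    have htw_mem := evalFrom_dialectDFA_mem (F := F) hm hn ht w
  · exact hw (hF _ hsw_mem _ htw_mem (hN _ _ hsw hsN) hw_eq)
  · exact hw (hF _ htw_mem _ hsw_mem (hN _ _ htw (hN _ _ hst hsN)) hw_eq.symm |>.symm)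

theorem fst_eq_final_iff_of_acceptsFrom_eq (hm : 5 ≤ m) (hn : 5 ≤ n)
    (hF : ¬((1, n) ∈ F ↔ (m, n) ∈ F)) {s t : ℕ × ℕ} (hs : s ∈ statePairs m n)
    (ht : t ∈ statePairs m n)
    (h : (dialectDFA m n F).acceptsFrom s = (dialectDFA m n F).acceptsFrom t) :
    s.1 = m ↔ t.1 = m := by
  obtain ⟨w, hw₁, hw₂⟩ := exists_evalFrom_baDFA_eq_final hm hn
  have fst_image : ∀ p ≤ m, (abDFA m).evalFrom p w = if p = m then m else 1 := by
    intro p hp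
    split_ifs with hpm
    · rw [hpm, evalFrom_abDFA_final hm]
    · exact hw₁ p (by omega)
  have hw : w ∈ (dialectDFA m n F).acceptsFrom s ↔ w ∈ (dialectDFA m n F).acceptsFrom t := by
    rw [h]
  rw [mem_acceptsFrom_dialectDFA, mem_acceptsFrom_dialectDFA, hw₂ _ hs.2.2, hw₂ _ ht.2.2,
    fst_image _ hs.1.2, fst_image _ ht.1.2] at hw
  grind

theorem snd_eq_final_iff_of_acceptsFrom_eq (hm : 5 ≤ m) (hn : 5 ≤ n)
    (hF : ¬((m, 1) ∈ F ↔ (m, n) ∈ F)) {s t : ℕ × ℕ} (hs : s ∈ statePairs m n)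
    (ht : t ∈ statePairs m n)
    (h : (dialectDFA m n F).acceptsFrom s = (dialectDFA m n F).acceptsFrom t) :
    s.2 = n ↔ t.2 = n := by
  obtain ⟨w, hw₁, hw₂⟩ := exists_evalFrom_abDFA_eq_final hm hn
  have snd_image : ∀ q ≤ n, (baDFA n).evalFrom q w = if q = n then n else 1 := by
    intro q hq
    split_ifs with hqn
    · rw [hqn, evalFrom_baDFA_final hn]
    · exact hw₂ q (by omega)
  have hw : w ∈ (dialectDFA m n F).acceptsFrom s ↔ w ∈ (dialectDFA m n F).acceptsFrom t := by
    rw [h]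
  rw [mem_acceptsFrom_dialectDFA, mem_acceptsFrom_dialectDFA, hw₁ _ hs.1.2, hw₁ _ ht.1.2,
    snd_image _ hs.2.2, snd_image _ ht.2.2] at hw
  grind

end Separation

section BooleanOperations

variable {m n : ℕ} {F : Set (ℕ × ℕ)}

theorem ncard_Icc_one_prod_Icc_one (k l : ℕ) :
    (Set.Icc 1 k ×ˢ Set.Icc 1 l : Set (ℕ × ℕ)).ncard = k * l := by
  rw [Set.ncard_prod]
  simp only [Set.ncard_eq_toFinset_card', Set.toFinset_Icc, Nat.card_Icc, Nat.add_sub_cancel]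

theorem complexity_dialectDFA_eq_mul (hm : 5 ≤ m) (hn : 5 ≤ n)
    (h_fst : ¬((1, n) ∈ F ↔ (m, n) ∈ F)) (h_snd : ¬((m, 1) ∈ F ↔ (m, n) ∈ F)) :
    complexity (dialectDFA m n F).accepts = m * n := by
  have range_eval := range_eval_dialectDFA (F := F) hm hn
  rw [complexity_accepts_of_injOn, range_eval, ncard_Icc_one_prod_Icc_one]
  rw [range_eval]
  intro s hs t ht h
  refine eq_of_acceptsFrom_eq (N := Set.univ) hm hn (fun _ _ _ _ => trivial) ?_ hs ht trivial h
  exact fun s hs t ht _ h => ⟨fst_eq_final_iff_of_acceptsFrom_eq hm hn h_fst hs ht h,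
    snd_eq_final_iff_of_acceptsFrom_eq hm hn h_snd hs ht h⟩

theorem complexity_dialectDFA_eq_ncard_inter_add_one (hm : 5 ≤ m) (hn : 5 ≤ n) {N : Set (ℕ × ℕ)}
    {c : ℕ × ℕ} (hc : c ∈ statePairs m n) (hcN : c ∉ N)
    (hN : ∀ s t, SameFinality m n s t → s ∈ N → t ∈ N)
    (hcollapse : ∀ s ∉ N, (dialectDFA m n F).acceptsFrom s = (dialectDFA m n F).acceptsFrom c)
    (hF : ∀ s ∈ statePairs m n, ∀ t ∈ statePairs m n, s ∈ N →
      (dialectDFA m n F).acceptsFrom s = (dialectDFA m n F).acceptsFrom t → SameFinality m n s t) :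
    complexity (dialectDFA m n F).accepts = (statePairs m n ∩ N).ncard + 1 := by
  have range_eval := range_eval_dialectDFA (F := F) hm hn
  have statePairs_finite : (statePairs m n).Finite :=
    (Set.finite_Icc _ _).prod (Set.finite_Icc _ _)
  rw [← range_eval] at statePairs_finite hc ⊢
  refine complexity_accepts_eq_ncard_inter_add_one statePairs_finite hc hcN
    (fun s _ => hcollapse s) ?_
  rw [range_eval]
  exact fun s hs t ht => eq_of_acceptsFrom_eq hm hn hN hF hs.1 ht hs.2

theorem complexity_dialectDFA_sdiff (hm : 5 ≤ m) (hn : 5 ≤ n) :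
    complexity (dialectDFA m n {s | s.1 = m ∧ s.2 ≠ n}).accepts = m * n - (m - 1) := by
  set F : Set (ℕ × ℕ) := {s | s.1 = m ∧ s.2 ≠ n}
  have acceptsFrom_eq_zero : ∀ s : ℕ × ℕ, s.2 = n → (dialectDFA m n F).acceptsFrom s = 0 := by
    rintro s hs
    ext w
    rw [mem_acceptsFrom_dialectDFA, hs, evalFrom_baDFA_final hn]
    exact iff_of_false (fun h => h.2 rfl) (Language.notMem_zero w)
  have statePairs_inter : statePairs m n ∩ {s | s.2 ≠ n} = Set.Icc 1 m ×ˢ Set.Icc 1 (n - 1) := by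
    ext s
    simp only [Set.mem_inter_iff, Set.mem_prod, Set.mem_Icc, Set.mem_ofPred_eq]
    omega
  rw [complexity_dialectDFA_eq_ncard_inter_add_one (N := {s | s.2 ≠ n}) (c := (1, n)) hm hn,
    statePairs_inter, ncard_Icc_one_prod_Icc_one]
  · have h_le : m ≤ m * n := Nat.le_mul_of_pos_right m (by omega)
    rw [Nat.mul_sub_one]
    omega
  · exact ⟨⟨le_rfl, by omega⟩, ⟨by omega, le_rfl⟩⟩
  · exact fun h => h rfl
  · exact fun s t hst => mt hst.2.mpr
  · intro s hs
    rw [acceptsFrom_eq_zero s (not_not.mp hs), acceptsFrom_eq_zero (1, n) rfl]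
  · intro s hs t ht hsN h
    have h_snd := snd_eq_final_iff_of_acceptsFrom_eq hm hn (by grind) hs ht h
    have h_F := mem_iff_of_acceptsFrom_eq h
    exact ⟨by grind, h_snd⟩

theorem complexity_dialectDFA_sup (hm : 5 ≤ m) (hn : 5 ≤ n) :
    complexity (dialectDFA m n {s | s.1 = m ∨ s.2 = n}).accepts = m * n - (m + n - 2) := by
  set F : Set (ℕ × ℕ) := {s | s.1 = m ∨ s.2 = n}
  have acceptsFrom_eq_univ : ∀ s ∈ F, (dialectDFA m n F).acceptsFrom s = Set.univ := by
    intro s hs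
    refine Set.eq_univ_of_forall fun w => mem_acceptsFrom_dialectDFA.mpr ?_
    obtain hs | hs := hs <;> rw [hs]
    · exact Or.inl (evalFrom_abDFA_final hm w)
    · exact Or.inr (evalFrom_baDFA_final hn w)
  have final_mem : (m, n) ∈ F := Or.inl rfl
  have statePairs_inter : statePairs m n ∩ Fᶜ = Set.Icc 1 (m - 1) ×ˢ Set.Icc 1 (n - 1) := by
    ext s
    simp only [F, Set.mem_inter_iff, Set.mem_prod, Set.mem_Icc, Set.mem_compl_iff,
      Set.mem_ofPred_eq]
    omega
  rw [complexity_dialectDFA_eq_ncard_inter_add_one (N := Fᶜ) (c := (m, n)) hm hn,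
    statePairs_inter, ncard_Icc_one_prod_Icc_one]
  · obtain ⟨k, rfl⟩ := Nat.exists_eq_add_of_le' (show 1 ≤ m by omega)
    obtain ⟨l, rfl⟩ := Nat.exists_eq_add_of_le' (show 1 ≤ n by omega)
    rw [Nat.add_sub_cancel, Nat.add_sub_cancel, show (k + 1) * (l + 1) = k * l + k + l + 1 by ring]
    omega
  · exact ⟨⟨by omega, le_rfl⟩, ⟨by omega, le_rfl⟩⟩
  · exact not_not.mpr final_mem
  · exact fun s t hst => mt (Or.imp hst.1.mpr hst.2.mpr)
  · intro s hs
    rw [acceptsFrom_eq_univ s (not_not.mp hs), acceptsFrom_eq_univ _ final_mem]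
  · intro s _ t _ hsF h
    have htF := mt (mem_iff_of_acceptsFrom_eq h).mpr hsF
    exact ⟨iff_of_false (hsF ∘ Or.inl) (htF ∘ Or.inl), iff_of_false (hsF ∘ Or.inr) (htF ∘ Or.inr)⟩

theorem witnessAB_inf_witnessBA (hm : 5 ≤ m) (hn : 5 ≤ n) :
    witnessAB m hm ⊓ witnessBA n hn = (dialectDFA m n {s | s.1 = m ∧ s.2 = n}).accepts := by
  rw [← accepts_abDFA, ← accepts_baDFA, accepts_dialectDFA]
  rfl

theorem symmDiff_witnessAB_witnessBA (hm : 5 ≤ m) (hn : 5 ≤ n) :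
    symmDiff (witnessAB m hm) (witnessBA n hn) =
      (dialectDFA m n {s | s.1 = m ∧ s.2 ≠ n ∨ s.2 = n ∧ s.1 ≠ m}).accepts := by
  rw [← accepts_abDFA, ← accepts_baDFA, accepts_dialectDFA]
  rfl

theorem witnessAB_sdiff_witnessBA (hm : 5 ≤ m) (hn : 5 ≤ n) :
    witnessAB m hm \ witnessBA n hn = (dialectDFA m n {s | s.1 = m ∧ s.2 ≠ n}).accepts := by
  rw [← accepts_abDFA, ← accepts_baDFA, accepts_dialectDFA]
  rfl

theorem witnessAB_sup_witnessBA (hm : 5 ≤ m) (hn : 5 ≤ n) :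
    witnessAB m hm ⊔ witnessBA n hn = (dialectDFA m n {s | s.1 = m ∨ s.2 = n}).accepts := by
  rw [← accepts_abDFA, ← accepts_baDFA, accepts_dialectDFA]
  rfl

end BooleanOperations

end TwoSidedIdeals

open TwoSidedIdeals in
theorem mainTheorem4 (m n : ℕ) (hm : 5 ≤ m) (hn : 5 ≤ n) :
    complexity (witnessAB m hm ⊓ witnessBA n hn) = m * n ∧
    complexity (symmDiff (witnessAB m hm) (witnessBA n hn)) = m * n ∧
    complexity (witnessAB m hm \ witnessBA n hn) = m * n - (m - 1) ∧
    complexity (witnessAB m hm ⊔ witnessBA n hn) = m * n - (m + n - 2) := by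
  rw [witnessAB_inf_witnessBA, symmDiff_witnessAB_witnessBA, witnessAB_sdiff_witnessBA,
    witnessAB_sup_witnessBA]
  exact ⟨complexity_dialectDFA_eq_mul hm hn (by grind) (by grind),
    complexity_dialectDFA_eq_mul hm hn (by grind) (by grind),
    complexity_dialectDFA_sdiff hm hn, complexity_dialectDFA_sup hm hn⟩
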